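/- **Theorem.** Consider the following two-stage robust representative selection problem. Given are a partition $T_1\cup\dots\cup T_\ell=[n]$ of the items $[n]=\{1,\dots,n\}$ with $|T_j|=2$ for all $j$, and real cost bounds $0\le\underline c_i\le\overline c_i$ for $i\in[n]$. Let $$\mathcal X_{\mathrm{nom}}=\Big\{x\in\{0,1\}^n:\ \sum_{i\in T_j}x_i=1\ \text{ for all } j\in[\ell]\Big\},$$ and, for $x\in\{0,1\}^n$, let $\mathcal X(x)=\{y\in\{0,1\}^n:\ x+y\le\mathbf 1,\ x+y\in\mathcal X_{\mathrm{nom}}\}$. For a budget $B\in\mathbb R$ let $$\mathcal U_B=\Big\{c\in\mathbb R^n_{\ge 0}:\ c_i=\underline c_i+(\overline c_i-\underline c_i)\delta_i,\ \delta_i\in\{0,1\}\ (i\in[n]),\ \sum_{i\in[n]}\delta_i\le B\Big\}.$$ The total budget is $\Gamma=1$, the first-stage uncertainty set is $\mathcal U=\mathcal U_1$, and for $c\in\mathcal U$ the second-stage uncertainty set, with the same cost bounds and the remaining budget, is $\mathcal U(c)=\mathcal U_{B(c)}$ with $B(c)=1-\sum_{i\in[n]}\frac{c_i-\underline c_i}{\overline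 c_i-\underline c_i}$, where summands with $\overline c_i=\underline c_i$ are read as $0$. For $x\in\{0,1\}^n$ put $$\textsc{Adv}(x)=\max_{c\in\mathcal U}\ \min_{y\in\mathcal X(x)}\ \max_{d\in\mathcal U(c)}\ \big(c^tx+d^ty\big),\qquad \textsc{Rob}=\min_{x\in\{0,1\}^n}\textsc{Adv}(x),$$ with $\min\emptyset=\infty$. There is an algorithm that, for every such instance, computes the optimal value $\textsc{Rob}$ and an optimal first-stage solution $x\in\{0,1\}^n$, that is, one with $\textsc{Adv}(x)=\textsc{Rob}$, in $O(n^3)$ time. Here an algorithm is one fixed program, independent of $n$ and of the instance, for a random access machine with registers and indirectly addressed memory for natural numbers and for real numbers, which counts one step for each addition, subtraction (truncated on naturals), comparison, copy, load, store, loading of a natural constant, and empty instruction, and has no other operations on numbers. The input is given as $n$, $\ell$, the index of the part of each item, and the numbers $\underline c_i$ and $\overline c_i$. -/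

import Mathlib

namespace TwoStage

/-! ## Two-stage robust problems with two-stage discrete budgeted uncertainty -/

section Problem

variable {n : ℕ}

/-- The set `{0,1}^n`, which is also the set of feasible first-stage solutions. -/
def binary (n : ℕ) : Set (Fin n → ℝ) :=
  {x | ∀ i, x i = 0 ∨ x i = 1}

/-- Feasible second-stage solutions for the first-stage solution `x`: the vectors `y ∈ {0,1}^n`
with `x + y ≤ 1` such that `x + y` is feasible for the nominal problem. -/
def secondStage (Xnom : Set (Fin n → ℝ)) (x : Fin n → ℝ) : Set (Fin n → ℝ) :=
  {y | y ∈ binary n ∧ (∀ i, x i + y i ≤ 1) ∧ x + y ∈ Xnom}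

/-- The discrete budgeted uncertainty set with budget `Γ` and cost bounds `lo`, `hi`. -/
def budgeted (Γ : ℝ) (lo hi : Fin n → ℝ) : Set (Fin n → ℝ) :=
  {c | (∀ i, 0 ≤ c i) ∧ ∃ δ ∈ binary n,
    (∀ i, c i = lo i + (hi i - lo i) * δ i) ∧ ∑ i, δ i ≤ Γ}

/-- The budget that the first-stage cost vector `c` has used up. An item with `lo i = hi i`
contributes `0 / 0 = 0`: its cost cannot be increased, so no budget is charged for it. -/
noncomputable def usedBudget (lo hi c : Fin n → ℝ) : ℝ :=
  ∑ i, (c i - lo i) / (hi i - lo i)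

/-- Data of a two-stage robust problem with two-stage discrete budgeted uncertainty: the feasible
set of the nominal problem, the budget, and the first- and second-stage cost bounds. -/
structure RobustProblem (n : ℕ) where
  Xnom : Set (Fin n → ℝ)
  Γ : ℝ
  cLo : Fin n → ℝ
  cHi : Fin n → ℝ
  dLo : Fin n → ℝ
  dHi : Fin n → ℝ

namespace RobustProblem

/-- The first-stage uncertainty set. -/
def U (I : RobustProblem n) : Set (Fin n → ℝ) :=
  budgeted I.Γ I.cLo I.cHi

/-- The second-stage uncertainty set, in which only the remaining budget is available. -/
def U₂ (I : RobustProblem n) (c : Fin n → ℝ) : Set (Fin n → ℝ) :=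
  budgeted (I.Γ - usedBudget I.cLo I.cHi c) I.dLo I.dHi

/-- `AdvRec(x, c, y) = max_{d ∈ U(c)} cᵗx + dᵗy`. -/
noncomputable def advRec (I : RobustProblem n) (x c y : Fin n → ℝ) : EReal :=
  ⨆ d ∈ I.U₂ c, ((∑ i, c i * x i + ∑ i, d i * y i : ℝ) : EReal)

/-- `Rec(x, c) = min_{y ∈ X(x)} AdvRec(x, c, y)`, which is `∞` if `X(x)` is empty. -/
noncomputable def recourse (I : RobustProblem n) (x c : Fin n → ℝ) : EReal :=
  ⨅ y ∈ secondStage I.Xnom x, I.advRec x c y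

/-- `Adv(x) = max_{c ∈ U} Rec(x, c)`. -/
noncomputable def adv (I : RobustProblem n) (x : Fin n → ℝ) : EReal :=
  ⨆ c ∈ I.U, I.recourse x c

/-- `Rob = min_{x ∈ {0,1}^n} Adv(x)`, the optimal value of the robust problem. -/
noncomputable def rob (I : RobustProblem n) : EReal :=
  ⨅ x ∈ binary n, I.adv x

end RobustProblem

/-- `T₁, …, T_ℓ` is a partition of the set of items. -/
def IsItemPartition {ℓ : ℕ} (T : Fin ℓ → Finset (Fin n)) : Prop :=
  (∀ j k, j ≠ k → Disjoint (T j) (T k)) ∧ ∀ i, ∃ j, i ∈ T j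

/-- Feasible solutions of representative selection: exactly one item is chosen from each part. -/
def repSelection {ℓ : ℕ} (T : Fin ℓ → Finset (Fin n)) : Set (Fin n → ℝ) :=
  {x | x ∈ binary n ∧ ∀ j, ∑ i ∈ T j, x i = 1}

/-- Two-stage representative selection with discrete budgeted uncertainty, budget `Γ = 1`, and
equal first- and second-stage cost bounds `lo`, `hi`. -/
def repSelectionEqualCosts {ℓ : ℕ} (T : Fin ℓ → Finset (Fin n)) (lo hi : Fin n → ℝ) :
    RobustProblem n where
  Xnom := repSelection T
  Γ := 1
  cLo := lo
  cHi := hi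
  dLo := lo
  dHi := hi

end Problem

/-! ## A unit-cost real random access machine

The machine has registers and an indirectly addressed memory for natural numbers (used as indices,
counters and flags), and the same for real numbers. Programs are structured (sequence, branch,
loop). On reals they can only add, subtract, compare and copy; on naturals they can moreover load
constants (subtraction is truncated). Every instruction and every evaluation of a test is one
step. -/

/-- A configuration of the machine. -/
structure State where
  nreg : ℕ → ℕ
  nmem : ℕ → ℕ
  rreg : ℕ → ℝ
  rmem : ℕ → ℝ

/-- Elementary instructions; the arguments are register numbers, except for the constant `k`. -/
inductive Instr where
  | nconst (a k : ℕ)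
  | ncopy (a b : ℕ)
  | nadd (a b c : ℕ)
  | nsub (a b c : ℕ)
  | nload (a b : ℕ)
  | nstore (a b : ℕ)
  | rcopy (a b : ℕ)
  | radd (a b c : ℕ)
  | rsub (a b c : ℕ)
  | rload (a b : ℕ)
  | rstore (a b : ℕ)

/-- The effect of an instruction. `load a b` reads into register `a` the memory cell whose address
is in natural register `b`; `store a b` writes register `b` to the memory cell whose address is in
natural register `a`. -/
noncomputable def Instr.apply (s : State) : Instr → State
  | .nconst a k => { s with nreg := Function.update s.nreg a k }
  | .ncopy a b => { s with nreg := Function.update s.nreg a (s.nreg b) }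
  | .nadd a b c => { s with nreg := Function.update s.nreg a (s.nreg b + s.nreg c) }
  | .nsub a b c => { s with nreg := Function.update s.nreg a (s.nreg b - s.nreg c) }
  | .nload a b => { s with nreg := Function.update s.nreg a (s.nmem (s.nreg b)) }
  | .nstore a b => { s with nmem := Function.update s.nmem (s.nreg a) (s.nreg b) }
  | .rcopy a b => { s with rreg := Function.update s.rreg a (s.rreg b) }
  | .radd a b c => { s with rreg := Function.update s.rreg a (s.rreg b + s.rreg c) }
  | .rsub a b c => { s with rreg := Function.update s.rreg a (s.rreg b - s.rreg c) }
  | .rload a b => { s with rreg := Function.update s.rreg a (s.rmem (s.nreg b)) }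
  | .rstore a b => { s with rmem := Function.update s.rmem (s.nreg a) (s.rreg b) }

/-- Elementary tests, comparing two registers. -/
inductive Test where
  | nlt (a b : ℕ)
  | neq (a b : ℕ)
  | rle (a b : ℕ)

/-- The outcome of a test. -/
def Test.Holds (s : State) : Test → Prop
  | .nlt a b => s.nreg a < s.nreg b
  | .neq a b => s.nreg a = s.nreg b
  | .rle a b => s.rreg a ≤ s.rreg b

/-- Programs. A program is a finite object that does not depend on the input. -/
inductive Program where
  | skip
  | instr (i : Instr)
  | seq (P Q : Program)
  | ite (b : Test) (P Q : Program)
  | loop (b : Test) (P : Program)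

/-- `Exec P s t s'`: started in configuration `s`, the program `P` halts after exactly `t` steps in
configuration `s'`. Here `loop b P` is the loop "while `b` do `P`". -/
inductive Exec : Program → State → ℕ → State → Prop where
  | skip (s : State) : Exec .skip s 1 s
  | instr (i : Instr) (s : State) : Exec (.instr i) s 1 (i.apply s)
  | seq {P Q : Program} {s u v : State} {k m : ℕ} :
      Exec P s k u → Exec Q u m v → Exec (.seq P Q) s (k + m) v
  | iteTrue {b : Test} {P Q : Program} {s u : State} {k : ℕ} :
      b.Holds s → Exec P s k u → Exec (.ite b P Q) s (1 + k) u
  | iteFalse {b : Test} {P Q : Program} {s u : State} {k : ℕ} :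
      ¬ b.Holds s → Exec Q s k u → Exec (.ite b P Q) s (1 + k) u
  | loopDone {b : Test} {P : Program} {s : State} :
      ¬ b.Holds s → Exec (.loop b P) s 1 s
  | loopStep {b : Test} {P : Program} {s u v : State} {k m : ℕ} :
      b.Holds s → Exec P s k u → Exec (.loop b P) u m v →
      Exec (.loop b P) s (1 + k + m) v

/-- The machine is deterministic: step count and final configuration are determined by the program
and the initial configuration. -/
theorem Exec.deterministic {P : Program} {s u : State} {k : ℕ} (h : Exec P s k u) :
    ∀ {m : ℕ} {v : State}, Exec P s m v → k = m ∧ u = v := by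
  induction h with
  | skip s => intro m v h; cases h; exact ⟨rfl, rfl⟩
  | instr i s => intro m v h; cases h; exact ⟨rfl, rfl⟩
  | seq _ _ ih₁ ih₂ =>
    intro m v h
    cases h with
    | seq h₁ h₂ =>
      obtain ⟨rfl, rfl⟩ := ih₁ h₁
      obtain ⟨rfl, rfl⟩ := ih₂ h₂
      exact ⟨rfl, rfl⟩
  | iteTrue hb _ ih =>
    intro m v h
    cases h with
    | iteTrue _ h₁ => obtain ⟨rfl, rfl⟩ := ih h₁; exact ⟨rfl, rfl⟩
    | iteFalse hn _ => exact absurd hb hn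
  | iteFalse hb _ ih =>
    intro m v h
    cases h with
    | iteTrue hp _ => exact absurd hp hb
    | iteFalse _ h₁ => obtain ⟨rfl, rfl⟩ := ih h₁; exact ⟨rfl, rfl⟩
  | loopDone hb =>
    intro m v h
    cases h with
    | loopDone _ => exact ⟨rfl, rfl⟩
    | loopStep hp _ _ => exact absurd hp hb
  | loopStep hb _ _ ih₁ ih₂ =>
    intro m v h
    cases h with
    | loopDone hn => exact absurd hb hn
    | loopStep _ h₁ h₂ =>
      obtain ⟨rfl, rfl⟩ := ih₁ h₁
      obtain ⟨rfl, rfl⟩ := ih₂ h₂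
      exact ⟨rfl, rfl⟩

/-- The configuration `s` holds the input: the natural registers `0` and `1` contain `n` and `ℓ`,
the natural memory cell `i < n` contains the index of the part of item `i`, and the real memory
cells `i` and `n + i` contain the lower and the upper cost bound of item `i`. Nothing is assumed on
the other registers and cells. -/
def HoldsInput {n ℓ : ℕ} (T : Fin ℓ → Finset (Fin n)) (lo hi : Fin n → ℝ) (s : State) : Prop :=
  s.nreg 0 = n ∧ s.nreg 1 = ℓ ∧
  (∀ (i : Fin n) (j : Fin ℓ), i ∈ T j → s.nmem i = j) ∧
  (∀ i : Fin n, s.rmem i = lo i) ∧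
  (∀ i : Fin n, s.rmem (n + i) = hi i)

/-- The first-stage solution in a configuration: the natural memory cells `0, …, n - 1`. -/
def State.solution (n : ℕ) (s : State) : Fin n → ℝ :=
  fun i => (s.nmem i : ℝ)

/-- The configuration `s` holds the solution of the problem `I`: an optimal first-stage solution in
the natural memory cells `0, …, n - 1`, and the optimal value in the real register `0`. -/
def HoldsOptimum {n : ℕ} (I : RobustProblem n) (s : State) : Prop :=
  s.solution n ∈ binary n ∧ I.adv (s.solution n) = I.rob ∧ I.rob = ((s.rreg 0 : ℝ) : EReal)

end TwoStage

/-!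
The first-stage adversary with budget `1` either strikes one item, after which the second stage is
nominal, or waits, in which case one item of the second-stage solution is struck. Write
`dev i = hi i - lo i`. A first-stage solution `x` with answers `z` (after a strike) and `y` (after
waiting) thus costs the maximum of `lo·x + lo·z + max dev over x` and
`lo·x + lo·y + max dev over y`.

Fix upper bounds `D` and `θ` for the two maxima. Each part consists of a cheaper item `a`, its lead,
and the other item `b`, and contributes to both nominal sums. The contributions can be minimized
simultaneously, part by part, although the objective is a maximum of two sums: if `dev a ≤ θ`,
postponing costs `lo a` twice; if `dev a ≤ D`, so does buying `a` now. Otherwise `a` can at best be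
taken after a strike: if `dev b ≤ θ`, postponing costs `lo a` and `lo b`, and any other admissible
decision costs `lo b` twice; if only `dev b ≤ D`, buying `b` now is forced. This is the policy
`buy`, whose guarantee is `adv_buy_le`; that some pair of thresholds taken from `0` and the
deviations does at least as well as a given `x` is `le_adv_of_forall_policy`.

There are `(n + 1) ^ 2` pairs of thresholds, and the policy is evaluated in `O(n)` steps for each
once every item knows the other item of its part, which takes `O(n ^ 2)` steps. The program
`mateProgram` does the latter, `searchProgram` the former. Programs are verified with a total
correctness logic with step bounds, in which loop-free code is handled by weakest preconditions
(`wp.runs`) and loops by the rule `Runs.loop_lt`.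
-/

namespace TwoStage

/-! ### Total correctness with a step bound -/

/-- Started in `s`, the program `P` halts after at most `N` steps in a configuration
satisfying `Q`. -/
def Runs (P : Program) (N : ℕ) (Q : State → Prop) (s : State) : Prop :=
  ∃ (t : ℕ) (s' : State), Exec P s t s' ∧ t ≤ N ∧ Q s'

theorem Runs.mono {P : Program} {N M : ℕ} {Q R : State → Prop} {s : State}
    (h : Runs P N Q s) (hNM : N ≤ M) (hQR : ∀ s', Q s' → R s') : Runs P M R s := by
  obtain ⟨t, s', he, ht, hQ⟩ := h
  exact ⟨t, s', he, ht.trans hNM, hQR s' hQ⟩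

theorem Runs.seq {P P' : Program} {N N' : ℕ} {Q R : State → Prop} {s : State}
    (h : Runs P N Q s) (h' : ∀ s', Q s' → Runs P' N' R s') :
    Runs (.seq P P') (N + N') R s := by
  obtain ⟨t, u, he, ht, hQ⟩ := h
  obtain ⟨t', v, he', ht', hR⟩ := h' u hQ
  exact ⟨t + t', v, .seq he he', by omega, hR⟩

/-- The rule for a loop in which the natural register `a` counts up to the content `N` of the
natural register `b`. -/
theorem Runs.loop_lt {P : Program} {a b N M : ℕ} (Inv : ℕ → State → Prop)
    (hreg : ∀ k s, Inv k s → s.nreg a = k ∧ s.nreg b = N)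
    (hstep : ∀ k s, k < N → Inv k s → Runs P M (Inv (k + 1)) s) {s : State} (h0 : Inv 0 s) :
    Runs (.loop (.nlt a b) P) (N * (M + 1) + 1) (Inv N) s := by
  have key : ∀ r k, k + r = N → ∀ s, Inv k s →
      Runs (.loop (.nlt a b) P) (r * (M + 1) + 1) (Inv N) s := by
    intro r
    induction r with
    | zero =>
      intro k hk s hs
      obtain ⟨h1, h2⟩ := hreg k s hs
      obtain rfl : k = N := by omega
      exact ⟨1, s, .loopDone (by simp [Test.Holds, h1, h2]), by omega, hs⟩
    | succ r ih =>
      intro k hk s hs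
      obtain ⟨h1, h2⟩ := hreg k s hs
      obtain ⟨t, u, he, ht, hu⟩ := hstep k s (by omega) hs
      obtain ⟨t', v, he', ht', hv⟩ := ih (k + 1) (by omega) u hu
      refine ⟨1 + t + t', v, .loopStep ?_ he he', ?_, hv⟩
      · simp only [Test.Holds, h1, h2]; omega
      · rw [Nat.add_mul]; omega
  exact key N 0 (by omega) s h0

/-- The weakest precondition of a loop-free program. Programs with a loop get the precondition
`False`; they are treated with `Runs.loop_lt`. -/
def wp : Program → (State → Prop) → State → Prop
  | .skip, Q, s => Q s
  | .instr i, Q, s => Q (i.apply s)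
  | .seq P P', Q, s => wp P (wp P' Q) s
  | .ite b P P', Q, s => (b.Holds s → wp P Q s) ∧ (¬ b.Holds s → wp P' Q s)
  | .loop _ _, _, _ => False

/-- A bound on the number of steps of a loop-free program; meaningless if there is a loop. -/
def Program.size : Program → ℕ
  | .skip => 1
  | .instr _ => 1
  | .seq P P' => P.size + P'.size
  | .ite _ P P' => 1 + P.size + P'.size
  | .loop _ P => 1 + P.size

theorem wp.runs {P : Program} {Q : State → Prop} {s : State} (h : wp P Q s) :
    Runs P P.size Q s := by
  induction P generalizing Q s with
  | skip => exact ⟨1, s, .skip s, le_rfl, h⟩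
  | instr i => exact ⟨1, _, .instr i s, le_rfl, h⟩
  | seq P P' ih ih' => exact (ih h).seq fun s' hs' => ih' hs'
  | ite b P P' ih ih' =>
    by_cases hb : b.Holds s
    · obtain ⟨t, u, he, ht, hu⟩ := ih (h.1 hb)
      exact ⟨1 + t, u, .iteTrue hb he, by simp only [Program.size]; omega, hu⟩
    · obtain ⟨t, u, he, ht, hu⟩ := ih' (h.2 hb)
      exact ⟨1 + t, u, .iteFalse hb he, by simp only [Program.size]; omega, hu⟩
  | loop b P ih => exact h.elim

/-- Straight-line code. -/
def block : List Instr → Program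
  | [] => .skip
  | i :: l => .seq (.instr i) (block l)


/-! ### The threshold policy -/

section Policy

variable {ι : Type*} [LinearOrder ι]

/-- Of the two items of a part, `i` is the one with the smaller lower cost bound; ties are broken
by the index. Here and below `m i` is the other item of the part of `i`. -/
def IsLead (m : ι → ι) (lo : ι → ℝ) (i : ι) : Prop :=
  lo i < lo (m i) ∨ lo i = lo (m i) ∧ i < m i

/-- The part with lead `i` has an item of deviation at most `D` or at most `θ`. -/
def IsServed (m : ι → ι) (dev : ι → ℝ) (D θ : ℝ) (i : ι) : Prop :=
  dev i ≤ θ ∨ dev i ≤ D ∨ dev (m i) ≤ θ ∨ dev (m i) ≤ D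

open Classical in
/-- The first-stage decision of the policy with thresholds `D` (for items bought now) and `θ` (for
items bought later): a part is bought now only if its lead is too uncertain to be bought later,
and then either its lead is bought, if `D` admits this, or else the other item, if that one cannot
be bought later. -/
noncomputable def buy (m : ι → ι) (lo dev : ι → ℝ) (D θ : ℝ) (i : ι) : ℕ :=
  if IsLead m lo i then if ¬ dev i ≤ θ ∧ dev i ≤ D then 1 else 0
  else if ¬ dev (m i) ≤ θ ∧ ¬ dev (m i) ≤ D ∧ ¬ dev i ≤ θ then 1 else 0

open Classical in
/-- The nominal cost of the part with lead `i` under the policy if the adversary strikes in the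
first stage: a postponed part then contributes its lead. It is `0` if `i` is no lead, and
irrelevant if the part is not served. -/
noncomputable def costFirst (m : ι → ι) (lo dev : ι → ℝ) (D θ : ℝ) (i : ι) : ℝ :=
  if IsLead m lo i then
    if dev i ≤ θ ∨ dev i ≤ D ∨ dev (m i) ≤ θ then lo i else lo (m i)
  else 0

open Classical in
/-- The nominal cost of the part with lead `i` under the policy if the adversary waits for the
second stage, in which only items of deviation at most `θ` are then taken. It is `0` if `i` is no
lead, and irrelevant if the part is not served. -/
noncomputable def costSecond (m : ι → ι) (lo dev : ι → ℝ) (D θ : ℝ) (i : ι) : ℝ :=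
  if IsLead m lo i then if dev i ≤ θ ∨ dev i ≤ D then lo i else lo (m i) else 0

open Classical in
/-- The second-stage answer of the policy if the adversary has struck in the first stage. -/
noncomputable def answerFirst (m : ι → ι) (lo dev : ι → ℝ) (D θ : ℝ) (i : ι) : ℝ :=
  if IsLead m lo i ∧ (dev i ≤ θ ∨ ¬ dev i ≤ D ∧ dev (m i) ≤ θ) then 1 else 0

open Classical in
/-- The second-stage answer of the policy if the adversary may still strike. -/
noncomputable def answerSecond (m : ι → ι) (lo dev : ι → ℝ) (D θ : ℝ) (i : ι) : ℝ :=
  if IsLead m lo i then if dev i ≤ θ then 1 else 0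
  else if ¬ dev (m i) ≤ θ ∧ ¬ dev (m i) ≤ D ∧ dev i ≤ θ then 1 else 0

variable {m : ι → ι} {lo dev : ι → ℝ} {D θ : ℝ} {i : ι}

theorem isLead_mate_iff (hm : Function.Involutive m) (hne : ∀ i, m i ≠ i) (i : ι) :
    IsLead m lo (m i) ↔ ¬ IsLead m lo i := by
  have := hne i
  simp only [IsLead, hm i]
  rcases lt_trichotomy (lo i) (lo (m i)) with h | h | h
  · simp [h, h.not_gt, h.ne']
  · rcases lt_or_gt_of_ne this with h' | h' <;> simp [h, h', h'.not_gt]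
  · simp [h, h.not_gt, h.ne']

theorem IsLead.lo_le (h : IsLead m lo i) : lo i ≤ lo (m i) :=
  h.elim le_of_lt fun h => h.1.le

theorem buy_eq_zero_or_one : buy m lo dev D θ i = 0 ∨ buy m lo dev D θ i = 1 := by
  unfold buy; split_ifs <;> simp

open Classical in
theorem sum_eq_sum_lead [Fintype ι] (hm : Function.Involutive m) (hne : ∀ i, m i ≠ i)
    (f : ι → ℝ) :
    ∑ i, f i = ∑ i, if IsLead m lo i then f i + f (m i) else 0 := by
  rw [← Finset.sum_filter, Finset.sum_add_distrib,
    ← Finset.sum_filter_add_sum_filter_not Finset.univ (IsLead m lo) f]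
  congr 1
  refine Finset.sum_nbij' m m ?_ ?_ (fun i _ => hm i) (fun i _ => hm i) fun i _ => by rw [hm i]
  · intro i; simp [isLead_mate_iff hm hne]
  · intro i; simp [isLead_mate_iff hm hne]

end Policy

/-! ### The robust value and the thresholds -/

section Bounds

variable {n ℓ : ℕ} {T : Fin ℓ → Finset (Fin n)} {lo hi : Fin n → ℝ} {m : Fin n → Fin n}

/-- In a partition into parts of two items, every item has a mate. -/
theorem exists_mate (hT : IsItemPartition T) (h2 : ∀ j, (T j).card = 2) :
    ∃ m : Fin n → Fin n, Function.Involutive m ∧ (∀ i, m i ≠ i) ∧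
      (∀ i k j, i ∈ T j → (k ∈ T j ∧ k ≠ i ↔ k = m i)) ∧
      repSelection T = {x | x ∈ binary n ∧ ∀ i, x i + x (m i) = 1} := by
  have hex : ∀ i, ∃ k, ∃ j, T j = {i, k} ∧ i ≠ k := by
    intro i
    obtain ⟨j, hj⟩ := hT.2 i
    obtain ⟨a, b, hab, hTj⟩ := Finset.card_eq_two.1 (h2 j)
    rw [hTj] at hj
    rcases Finset.mem_insert.1 hj with rfl | hb
    · exact ⟨b, j, hTj, hab⟩
    · rw [Finset.mem_singleton] at hb
      subst hb
      exact ⟨a, j, by rw [hTj, Finset.pair_comm], hab.symm⟩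
  choose m p hp hne using hex
  have huniq : ∀ i j, i ∈ T j → j = p i := by
    intro i j hij
    by_contra hjp
    exact Finset.disjoint_left.1 (hT.1 _ _ hjp) hij (by simp [hp])
  have hmate : ∀ i k j, i ∈ T j → (k ∈ T j ∧ k ≠ i ↔ k = m i) := by
    intro i k j hij
    rw [huniq i j hij, hp]
    have := hne i
    simp only [Finset.mem_insert, Finset.mem_singleton]
    constructor
    · rintro ⟨rfl | h, h'⟩
      · exact absurd rfl h'
      · exact h
    · rintro rfl
      exact ⟨.inr rfl, this.symm⟩
  refine ⟨m, fun i => ?_, fun i => (hne i).symm, hmate, ?_⟩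
  · exact ((hmate (m i) i (p i) (by simp [hp])).1 ⟨by simp [hp], hne i⟩).symm
  · ext x
    refine and_congr_right fun _ => ⟨fun h i => ?_, fun h j => ?_⟩
    · rw [← h (p i), hp, Finset.sum_pair (hne i)]
    · obtain ⟨i, hi⟩ := Finset.card_pos.1 (by rw [h2 j]; norm_num : 0 < (T j).card)
      rw [huniq i j hi, hp, Finset.sum_pair (hne i), h i]

theorem binary_nonneg {x : Fin n → ℝ} (hx : x ∈ binary n) (i : Fin n) : 0 ≤ x i := by
  rcases hx i with h | h <;> simp [h]

/-- If only entries of value at most `D` are selected by `x`, a unit budget buys at most `D`. -/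
theorem sum_dev_mul_le {x δ dev : Fin n → ℝ} {D : ℝ} (hx : x ∈ binary n) (hδ : δ ∈ binary n)
    (hsum : ∑ i, δ i ≤ 1) (hD : 0 ≤ D) (hdev : ∀ i, x i = 1 → dev i ≤ D) :
    ∑ i, dev i * δ i * x i ≤ D := by
  calc ∑ i, dev i * δ i * x i ≤ ∑ i, D * δ i := by
        refine Finset.sum_le_sum fun i _ => ?_
        have := binary_nonneg hδ i
        rcases hx i with h | h
        · rw [h]; simpa using mul_nonneg hD this
        · rw [h, mul_one]; exact mul_le_mul_of_nonneg_right (hdev i h) this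
    _ = D * ∑ i, δ i := by rw [Finset.mul_sum]
    _ ≤ D := by nlinarith

/-- The policy with thresholds `D` and `θ` guarantees the cost `max (D + ∑ costFirst)
(θ + ∑ costSecond)`: if the adversary strikes an item bought in the first stage, it costs at most
`D` and the second stage is nominal; otherwise the second stage is restricted to items of deviation
at most `θ`. -/
theorem adv_buy_le (hm : Function.Involutive m) (hne : ∀ i, m i ≠ i)
    (hX : repSelection T = {x | x ∈ binary n ∧ ∀ i, x i + x (m i) = 1}) {D θ : ℝ} (hD : 0 ≤ D)
    (hθ : 0 ≤ θ) (hserved : ∀ i, IsLead m lo i → IsServed m (fun i => hi i - lo i) D θ i) :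
    (repSelectionEqualCosts T lo hi).adv (fun i => (buy m lo (fun i => hi i - lo i) D θ i : ℝ)) ≤
      ((max (D + ∑ i, costFirst m lo (fun i => hi i - lo i) D θ i)
        (θ + ∑ i, costSecond m lo (fun i => hi i - lo i) D θ i) : ℝ) : EReal) := by
  classical
  set dev : Fin n → ℝ := fun i => hi i - lo i with hdev
  set x : Fin n → ℝ := fun i => (buy m lo dev D θ i : ℝ) with hxdef
  have hx : x ∈ binary n := fun i => by
    rcases buy_eq_zero_or_one (m := m) (lo := lo) (dev := dev) (D := D) (θ := θ) (i := i) with h | h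
      <;> simp [hxdef, h]
  have hlead := isLead_mate_iff (lo := lo) hm hne
  have hxD : ∀ i, x i = 1 → dev i ≤ D := by
    intro i h1
    by_cases hi : IsLead m lo i
    · simp only [hxdef, buy, hi] at h1
      by_contra hc
      simp [hc] at h1
    · have hs := hserved (m i) ((hlead i).2 hi)
      simp only [IsServed, hm i] at hs
      simp only [hxdef, buy, hi] at h1
      by_contra hc
      have h2 : ¬ (¬ dev (m i) ≤ θ ∧ ¬ dev (m i) ≤ D ∧ ¬ dev i ≤ θ) := by tauto
      rw [if_neg (by simp), if_neg h2] at h1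
      simp at h1
  -- the two second-stage answers complement the first-stage decision
  have hcompl : ∀ y : Fin n → ℝ, y ∈ binary n → (∀ i, IsLead m lo i →
      x i + y i + (x (m i) + y (m i)) = 1) → y ∈ secondStage (repSelection T) x := by
    intro y hy h
    have hall : ∀ i, x i + y i + (x (m i) + y (m i)) = 1 := by
      intro i
      by_cases hi : IsLead m lo i
      · exact h i hi
      · have := h (m i) ((hlead i).2 hi)
        rw [hm i] at this
        linarith
    have hle : ∀ i, x i + y i ≤ 1 := fun i => by
      have := hall i
      have := binary_nonneg hx (m i)
      have := binary_nonneg hy (m i)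
      linarith
    refine ⟨hy, hle, ?_⟩
    rw [hX]
    refine ⟨fun i => ?_, fun i => by simpa using hall i⟩
    have := hle i
    rcases hx i with h1 | h1 <;> rcases hy i with h2 | h2 <;> simp [h1, h2] at this ⊢
    norm_num at this
  set z : Fin n → ℝ := answerFirst m lo dev D θ with hz
  set y : Fin n → ℝ := answerSecond m lo dev D θ with hy
  have hzb : z ∈ binary n := fun i => by simp only [hz, answerFirst]; split_ifs <;> simp
  have hyb : y ∈ binary n := fun i => by simp only [hy, answerSecond]; split_ifs <;> simp
  have hzX : z ∈ secondStage (repSelection T) x := by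
    refine hcompl z hzb fun i hi => ?_
    have h' := (hlead i).not.2 (not_not.2 hi)
    have hs := hserved i hi
    simp only [IsServed] at hs
    simp only [hxdef, hz, buy, answerFirst, hi, h', hm i]
    by_cases h1 : dev i ≤ θ <;> by_cases h2 : dev i ≤ D <;> by_cases h3 : dev (m i) ≤ θ <;>
      simp [h1, h2, h3]
  have hyX : y ∈ secondStage (repSelection T) x := by
    refine hcompl y hyb fun i hi => ?_
    have h' := (hlead i).not.2 (not_not.2 hi)
    simp only [hxdef, hy, buy, answerSecond, hi, h', hm i]
    by_cases h1 : dev i ≤ θ <;> by_cases h2 : dev i ≤ D <;> by_cases h3 : dev (m i) ≤ θ <;>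
      simp [h1, h2, h3]
  have hyθ : ∀ i, y i = 1 → dev i ≤ θ := by
    intro i h1
    by_contra hc
    simp [hy, answerSecond, hc] at h1
  have hzsum : ∑ i, lo i * x i + ∑ i, lo i * z i = ∑ i, costFirst m lo dev D θ i := by
    rw [← Finset.sum_add_distrib, sum_eq_sum_lead (lo := lo) hm hne]
    refine Finset.sum_congr rfl fun i _ => ?_
    by_cases hi : IsLead m lo i
    · have h' := (hlead i).not.2 (not_not.2 hi)
      simp only [hxdef, hz, buy, answerFirst, costFirst, hi, h', hm i]
      by_cases h1 : dev i ≤ θ <;> by_cases h2 : dev i ≤ D <;> by_cases h3 : dev (m i) ≤ θ <;>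
        simp [h1, h2, h3]
    · simp [costFirst, hi]
  have hysum : ∑ i, lo i * x i + ∑ i, lo i * y i = ∑ i, costSecond m lo dev D θ i := by
    rw [← Finset.sum_add_distrib, sum_eq_sum_lead (lo := lo) hm hne]
    refine Finset.sum_congr rfl fun i _ => ?_
    by_cases hi : IsLead m lo i
    · have h' := (hlead i).not.2 (not_not.2 hi)
      simp only [hxdef, hy, buy, answerSecond, costSecond, hi, h', hm i]
      by_cases h1 : dev i ≤ θ <;> by_cases h2 : dev i ≤ D <;> by_cases h3 : dev (m i) ≤ θ <;>
        simp [h1, h2, h3]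
    · simp [costSecond, hi]
  have hsplit : ∀ c δ w : Fin n → ℝ, (∀ i, c i = lo i + (hi i - lo i) * δ i) →
      ∑ i, c i * w i = ∑ i, lo i * w i + ∑ i, dev i * δ i * w i := by
    intro c δ w h
    rw [← Finset.sum_add_distrib]
    exact Finset.sum_congr rfl fun i _ => by rw [h i]; ring
  refine iSup₂_le fun c hc => ?_
  obtain ⟨-, δ, hδ, hcδ, hδ1⟩ := hc
  change ∑ i, δ i ≤ 1 at hδ1
  change ∀ i, c i = lo i + (hi i - lo i) * δ i at hcδ
  have hused : usedBudget lo hi c = ∑ i, if dev i = 0 then 0 else δ i := by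
    refine Finset.sum_congr rfl fun i _ => ?_
    rw [hcδ i]
    split_ifs with h
    · simp [show hi i - lo i = 0 from h]
    · have : hi i - lo i ≠ 0 := h
      field_simp
      ring
  by_cases hstrike : ∃ k, dev k ≠ 0 ∧ δ k = 1
  · obtain ⟨k, hk0, hk1⟩ := hstrike
    refine (iInf₂_le z hzX).trans (iSup₂_le fun d hd => ?_)
    obtain ⟨-, δ', hδ', hdδ', hδ'1⟩ := hd
    change ∑ i, δ' i ≤ 1 - usedBudget lo hi c at hδ'1
    change ∀ i, d i = lo i + (hi i - lo i) * δ' i at hdδ'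
    have h1 : 1 ≤ usedBudget lo hi c := by
      rw [hused]
      have := Finset.single_le_sum (f := fun i => if dev i = 0 then 0 else δ i)
        (fun i _ => by split_ifs; exacts [le_rfl, binary_nonneg hδ i])
        (Finset.mem_univ k)
      simpa [hk0, hk1] using this
    have h0 : ∀ i, δ' i = 0 := by
      have hs : ∑ i, δ' i = 0 := le_antisymm (by linarith)
        (Finset.sum_nonneg fun i _ => binary_nonneg hδ' i)
      intro i
      exact (Finset.sum_eq_zero_iff_of_nonneg fun i _ => binary_nonneg hδ' i).1 hs i
        (Finset.mem_univ i)
    refine EReal.coe_le_coe_iff.2 (le_max_of_le_left ?_)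
    rw [hsplit c δ x hcδ, hsplit d δ' z hdδ', ← hzsum]
    have := sum_dev_mul_le hx hδ hδ1 hD hxD
    simp only [h0, mul_zero, zero_mul, Finset.sum_const_zero]
    linarith
  · push Not at hstrike
    -- a strike on an item of deviation `0` changes no cost and uses no budget
    have hzero : ∀ i, dev i * δ i = 0 := by
      intro i
      by_cases h : dev i = 0
      · simp [h]
      · rw [(hδ i).resolve_right (hstrike i h), mul_zero]
    refine (iInf₂_le y hyX).trans (iSup₂_le fun d hd => ?_)
    obtain ⟨-, δ', hδ', hdδ', hδ'1⟩ := hd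
    change ∑ i, δ' i ≤ 1 - usedBudget lo hi c at hδ'1
    change ∀ i, d i = lo i + (hi i - lo i) * δ' i at hdδ'
    have h1 : 0 ≤ usedBudget lo hi c := by
      rw [hused]
      exact Finset.sum_nonneg fun i _ => by split_ifs; exacts [le_rfl, binary_nonneg hδ i]
    refine EReal.coe_le_coe_iff.2 (le_max_of_le_right ?_)
    rw [hsplit c δ x hcδ, hsplit d δ' y hdδ', ← hysum]
    have := sum_dev_mul_le hyb hδ' (by linarith) hθ hyθ
    simp only [hzero, zero_mul, Finset.sum_const_zero]
    linarith

/-- With a unit budget the adversary can charge the largest deviation selected by `w`, or nothing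
if `w = 0`. -/
theorem exists_strike (dev w : Fin n → ℝ) :
    ∃ E : ℝ, (E = 0 ∨ ∃ u, E = dev u) ∧ (∀ i, w i = 1 → dev i ≤ E) ∧
      ∃ δ ∈ binary n, ∑ i, δ i ≤ 1 ∧ ∑ i, dev i * δ i * w i = E := by
  classical
  by_cases hempty : ∃ i, w i = 1
  · obtain ⟨u, hu, hmax⟩ := Finset.exists_max_image (Finset.univ.filter fun i => w i = 1) dev
      (by obtain ⟨i, h⟩ := hempty; exact ⟨i, by simp [h]⟩)
    rw [Finset.mem_filter] at hu
    refine ⟨dev u, .inr ⟨u, rfl⟩, fun i h => hmax i (by simp [h]), Pi.single u 1, ?_, ?_, ?_⟩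
    · intro i
      by_cases h : i = u
      · subst h; simp
      · simp [h]
    · simp
    · simp [Pi.single_apply, hu.2]
  · push Not at hempty
    exact ⟨0, .inl rfl, fun i h => absurd h (hempty i), 0, fun i => .inl rfl, by simp, by simp⟩

/-- If `x + w` is feasible, exactly one of `x i`, `w i`, `x (m i)`, `w (m i)` is `1`. -/
theorem selects_one {x w : Fin n → ℝ} (hx : x ∈ binary n) (hw : w ∈ binary n) {i : Fin n}
    (h : x i + w i + (x (m i) + w (m i)) = 1) :
    (x i = 1 ∧ w i = 0 ∧ x (m i) = 0 ∧ w (m i) = 0) ∨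
    (x i = 0 ∧ w i = 1 ∧ x (m i) = 0 ∧ w (m i) = 0) ∨
    (x i = 0 ∧ w i = 0 ∧ x (m i) = 1 ∧ w (m i) = 0) ∨
    (x i = 0 ∧ w i = 0 ∧ x (m i) = 0 ∧ w (m i) = 1) := by
  rcases hx i with h1 | h1 <;> rcases hw i with h2 | h2 <;> rcases hx (m i) with h3 | h3 <;>
    rcases hw (m i) with h4 | h4 <;> rw [h1, h2, h3, h4] at h <;> norm_num at h <;>
    simp [h1, h2, h3, h4]

theorem sum_costFirst_le (hm : Function.Involutive m) (hne : ∀ i, m i ≠ i) {dev x y z : Fin n → ℝ}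
    {D θ : ℝ} (hx : x ∈ binary n) (hy : y ∈ binary n) (hz : z ∈ binary n)
    (hyp : ∀ i, x i + y i + (x (m i) + y (m i)) = 1)
    (hzp : ∀ i, x i + z i + (x (m i) + z (m i)) = 1)
    (hxD : ∀ i, x i = 1 → dev i ≤ D) (hyθ : ∀ i, y i = 1 → dev i ≤ θ) :
    ∑ i, costFirst m lo dev D θ i ≤ ∑ i, lo i * x i + ∑ i, lo i * z i := by
  classical
  rw [← Finset.sum_add_distrib,
    sum_eq_sum_lead (lo := lo) hm hne (fun i => lo i * x i + lo i * z i)]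
  refine Finset.sum_le_sum fun i _ => ?_
  unfold costFirst
  by_cases hi : IsLead m lo i
  · have hle := hi.lo_le
    have hcost : (if dev i ≤ θ ∨ dev i ≤ D ∨ dev (m i) ≤ θ then lo i else lo (m i)) ≤
        lo (m i) := by split_ifs <;> simp [hle]
    rw [if_pos hi, if_pos hi]
    rcases selects_one hx hz (hzp i) with ⟨h1, h2, h3, h4⟩ | ⟨h1, h2, h3, h4⟩ | ⟨h1, h2, h3, h4⟩ |
      ⟨h1, h2, h3, h4⟩
    · rw [if_pos (.inr (.inl (hxD i h1)))]; simp [h1, h2, h3, h4]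
    · have : dev i ≤ θ ∨ dev i ≤ D ∨ dev (m i) ≤ θ := by
        rcases selects_one hx hy (hyp i) with h | h | h | h
        · exact .inr (.inl (hxD i h.1))
        · exact .inl (hyθ i h.2.1)
        · exact absurd (h3.symm.trans h.2.2.1) zero_ne_one
        · exact .inr (.inr (hyθ (m i) h.2.2.2))
      rw [if_pos this]; simp [h1, h2, h3, h4]
    · simpa [h1, h2, h3, h4] using hcost
    · simpa [h1, h2, h3, h4] using hcost
  · rw [if_neg hi, if_neg hi]

theorem sum_costSecond_le (hm : Function.Involutive m) (hne : ∀ i, m i ≠ i)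
    {dev x y : Fin n → ℝ} {D θ : ℝ} (hx : x ∈ binary n) (hy : y ∈ binary n)
    (hyp : ∀ i, x i + y i + (x (m i) + y (m i)) = 1)
    (hxD : ∀ i, x i = 1 → dev i ≤ D) (hyθ : ∀ i, y i = 1 → dev i ≤ θ) :
    ∑ i, costSecond m lo dev D θ i ≤ ∑ i, lo i * x i + ∑ i, lo i * y i := by
  classical
  rw [← Finset.sum_add_distrib,
    sum_eq_sum_lead (lo := lo) hm hne (fun i => lo i * x i + lo i * y i)]
  refine Finset.sum_le_sum fun i _ => ?_
  unfold costSecond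
  by_cases hi : IsLead m lo i
  · have hle := hi.lo_le
    have hcost : (if dev i ≤ θ ∨ dev i ≤ D then lo i else lo (m i)) ≤ lo (m i) := by
      split_ifs <;> simp [hle]
    rw [if_pos hi, if_pos hi]
    rcases selects_one hx hy (hyp i) with ⟨h1, h2, h3, h4⟩ | ⟨h1, h2, h3, h4⟩ | ⟨h1, h2, h3, h4⟩ |
      ⟨h1, h2, h3, h4⟩
    · rw [if_pos (.inr (hxD i h1))]; simp [h1, h2, h3, h4]
    · rw [if_pos (.inl (hyθ i h2))]; simp [h1, h2, h3, h4]
    · simpa [h1, h2, h3, h4] using hcost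
    · simpa [h1, h2, h3, h4] using hcost
  · rw [if_neg hi, if_neg hi]

/-- No first-stage solution beats all policies whose thresholds are `0` or a deviation. For a
solution `x` and an optimal answer `y` to the nominal first-stage scenario, take for `D` and `θ`
the largest deviations selected by `x` and by `y`; part by part the policy is then at least as good
as `x` and its answers. -/
theorem le_adv_of_forall_policy (hlohi : ∀ i, 0 ≤ lo i ∧ lo i ≤ hi i)
    (hm : Function.Involutive m) (hne : ∀ i, m i ≠ i)
    (hX : repSelection T = {x | x ∈ binary n ∧ ∀ i, x i + x (m i) = 1}) {β : ℝ}
    (hβ : ∀ D θ : ℝ, (D = 0 ∨ ∃ u, D = hi u - lo u) → (θ = 0 ∨ ∃ v, θ = hi v - lo v) →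
      (∀ i, IsLead m lo i → IsServed m (fun i => hi i - lo i) D θ i) →
      β ≤ max (D + ∑ i, costFirst m lo (fun i => hi i - lo i) D θ i)
        (θ + ∑ i, costSecond m lo (fun i => hi i - lo i) D θ i))
    {x : Fin n → ℝ} (hx : x ∈ binary n) :
    (β : EReal) ≤ (repSelectionEqualCosts T lo hi).adv x := by
  classical
  set dev : Fin n → ℝ := fun i => hi i - lo i with hdev
  have hdev0 : ∀ i, 0 ≤ dev i := fun i => sub_nonneg.2 (hlohi i).2
  have hlead := isLead_mate_iff (lo := lo) hm hne
  by_contra hlt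
  rw [not_le] at hlt
  have hmem : ∀ Γ : ℝ, ∀ δ ∈ binary n, ∑ i, δ i ≤ Γ →
      (fun i => lo i + dev i * δ i) ∈ budgeted Γ lo hi := by
    intro Γ δ hδ h
    exact ⟨fun i => add_nonneg (hlohi i).1 (mul_nonneg (hdev0 i) (binary_nonneg hδ i)), δ, hδ,
      fun i => rfl, h⟩
  have hsplit : ∀ δ w : Fin n → ℝ, ∑ i, (lo i + dev i * δ i) * w i =
      ∑ i, lo i * w i + ∑ i, dev i * δ i * w i := by
    intro δ w
    rw [← Finset.sum_add_distrib]
    exact Finset.sum_congr rfl fun i _ => by ring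
  have husedle : ∀ δ ∈ binary n,
      usedBudget lo hi (fun i => lo i + dev i * δ i) ≤ ∑ i, δ i := by
    intro δ hδ
    refine Finset.sum_le_sum fun i _ => ?_
    by_cases h : dev i = 0
    · have : hi i - lo i = 0 := h
      simp [this, binary_nonneg hδ i]
    · have : hi i - lo i ≠ 0 := h
      simp [hdev, this]
  -- some answer beats `β` against each first-stage scenario and each affordable reaction
  have hrec : ∀ δ ∈ binary n, ∑ i, δ i ≤ 1 → ∃ y ∈ secondStage (repSelection T) x,
      ∀ δ' ∈ binary n,
        ∑ i, δ' i ≤ 1 - usedBudget lo hi (fun i => lo i + dev i * δ i) →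
        ∑ i, (lo i + dev i * δ i) * x i + ∑ i, (lo i + dev i * δ' i) * y i < β := by
    intro δ hδ h1
    have h := (le_iSup₂ (f := fun c (_ : c ∈ (repSelectionEqualCosts T lo hi).U) =>
      (repSelectionEqualCosts T lo hi).recourse x c) _ (hmem 1 δ hδ h1)).trans_lt hlt
    obtain ⟨y, hy, hlt'⟩ := by simpa only [RobustProblem.recourse, iInf_lt_iff] using h
    refine ⟨y, hy, fun δ' hδ' h' => ?_⟩
    have h2 := (le_iSup₂ (f := fun d (_ : d ∈ (repSelectionEqualCosts T lo hi).U₂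
        (fun i => lo i + dev i * δ i)) =>
      ((∑ i, (lo i + dev i * δ i) * x i + ∑ i, d i * y i : ℝ) : EReal)) _
        (hmem _ δ' hδ' h')).trans_lt hlt'
    exact EReal.coe_lt_coe_iff.1 h2
  have h00 : (0 : Fin n → ℝ) ∈ binary n := fun i => .inl rfl
  obtain ⟨D, hDc, hxD, δ, hδ, hδ1, hδD⟩ := exists_strike dev x
  obtain ⟨z, ⟨hz, -, hzX⟩, hzβ⟩ := hrec δ hδ hδ1
  obtain ⟨y, ⟨hy, -, hyX⟩, hyβ⟩ := hrec 0 h00 (by simp)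
  obtain ⟨θ, hθc, hyθ, ε, hε, hε1, hεθ⟩ := exists_strike dev y
  replace hzβ := hzβ 0 h00 (by have := husedle δ hδ; simp; linarith)
  replace hyβ := hyβ ε hε (by simpa [usedBudget] using hε1)
  simp only [hsplit, hδD, hεθ, Pi.zero_apply, mul_zero, add_zero] at hzβ hyβ
  rw [hX] at hzX hyX
  have hzp : ∀ i, x i + z i + (x (m i) + z (m i)) = 1 := fun i => hzX.2 i
  have hyp : ∀ i, x i + y i + (x (m i) + y (m i)) = 1 := fun i => hyX.2 i
  have hserved : ∀ i, IsLead m lo i → IsServed m dev D θ i := by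
    intro i _
    rcases selects_one hx hy (hyp i) with h | h | h | h
    · exact .inr (.inl (hxD i h.1))
    · exact .inl (hyθ i h.2.1)
    · exact .inr (.inr (.inr (hxD (m i) h.2.2.1)))
    · exact .inr (.inr (.inl (hyθ (m i) h.2.2.2)))
  have hfirst := sum_costFirst_le (lo := lo) hm hne hx hy hz hyp hzp hxD hyθ
  have hsecond := sum_costSecond_le (lo := lo) hm hne hx hy hyp hxD hyθ
  have := hβ D θ hDc hθc hserved
  rcases le_max_iff.1 this with h | h <;> linarith

end Bounds

/-! ### One pass of the threshold policy -/

/-- What the configuration holds once the input has been prepared: `n`, `1`, `2 * n` and `n + 1` in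
the natural registers `0`, `1`, `3`, `12`; the mate of item `i` in the natural memory cell `n + i`;
the lower cost bound of `i` in the real memory cell `i` and its deviation in the cell `2 * n + i`.
The cell `3 * n` holds one more threshold, `dev n`. -/
structure Prepared (n : ℕ) (m : ℕ → ℕ) (lo dev : ℕ → ℝ) (s : State) : Prop where
  size : s.nreg 0 = n
  one : s.nreg 1 = 1
  twice : s.nreg 3 = n + n
  succ : s.nreg 12 = n + 1
  mate : ∀ i < n, s.nmem (n + i) = m i
  lower : ∀ i < n, s.rmem i = lo i
  deviation : ∀ i ≤ n, s.rmem (n + n + i) = dev i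

/-- The contribution of a part to the policy with thresholds `rreg 1` and `rreg 2`, executed at its
lead: `rreg 3` and `rreg 4` accumulate the two nominal costs, `nreg 13`, initially `0`, is the
first-stage decision for the lead, and `nreg 10` becomes `0` if the part is not served. -/
def leadProgram : Program :=
  .ite (.rle 7 2) (block [.radd 3 3 5, .radd 4 4 5])
    (.ite (.rle 7 1) (block [.nconst 13 1, .radd 3 3 5, .radd 4 4 5])
      (.ite (.rle 8 2) (block [.radd 3 3 5, .radd 4 4 6])
        (.ite (.rle 8 1) (block [.radd 3 3 6, .radd 4 4 6])
          (block [.nconst 10 0, .radd 3 3 6, .radd 4 4 6]))))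

/-- The first-stage decision for an item that is not the lead of its part. -/
def followProgram : Program :=
  .ite (.rle 8 2) .skip
    (.ite (.rle 8 1) .skip (.ite (.rle 7 2) .skip (.instr (.nconst 13 1))))

/-- The decision of the policy for the item in `nreg 6` with mate in `nreg 7`, whose lower cost
bounds are in `rreg 5`, `rreg 6` and whose deviations are in `rreg 7`, `rreg 8`. -/
def decideProgram : Program :=
  .ite (.rle 5 6) (.ite (.rle 6 5) (.ite (.nlt 6 7) leadProgram followProgram) leadProgram)
    followProgram

/-- Loads the data of the item in `nreg 6`, decides on it, and proceeds to the next item. -/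
def passBody : Program :=
  .seq (block [.nadd 8 0 6, .nload 7 8, .rload 5 6, .rload 6 7, .nadd 8 3 6, .rload 7 8,
      .nadd 8 3 7, .rload 8 8, .nconst 13 0])
    (.seq decideProgram (block [.nstore 6 13, .nadd 6 6 1]))

/-- Evaluates the policy with thresholds `rreg 1` and `rreg 2`: writes its first-stage solution to
the natural memory cells `0, …, n - 1`, its two cost totals to `rreg 3` and `rreg 4`, and sets
`nreg 10` to `1` if and only if all parts are served. -/
def passProgram : Program :=
  .seq (block [.nconst 6 0, .nconst 10 1, .rcopy 3 1, .rcopy 4 2]) (.loop (.nlt 6 0) passBody)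

section Pass

variable {n : ℕ} {m : ℕ → ℕ} {lo dev : ℕ → ℝ} {D θ : ℝ}

theorem runs_decideProgram {i : ℕ} {s : State} (h6 : s.nreg 6 = i) (h7 : s.nreg 7 = m i)
    (r1 : s.rreg 1 = D) (r2 : s.rreg 2 = θ) (r5 : s.rreg 5 = lo i) (r6 : s.rreg 6 = lo (m i))
    (r7 : s.rreg 7 = dev i) (r8 : s.rreg 8 = dev (m i)) (h13 : s.nreg 13 = 0) :
    Runs decideProgram decideProgram.size (fun s' => s'.nmem = s.nmem ∧ s'.rmem = s.rmem ∧
      (∀ a, a ≠ 10 → a ≠ 13 → s'.nreg a = s.nreg a) ∧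
      (∀ a, a ≠ 3 → a ≠ 4 → s'.rreg a = s.rreg a) ∧
      s'.rreg 3 = s.rreg 3 + costFirst m lo dev D θ i ∧
      s'.rreg 4 = s.rreg 4 + costSecond m lo dev D θ i ∧
      s'.nreg 13 = buy m lo dev D θ i ∧
      (s'.nreg 10 = 1 ↔ s.nreg 10 = 1 ∧ (IsLead m lo i → IsServed m dev D θ i))) s := by
  apply wp.runs
  have hlead : IsLead m lo i → wp leadProgram (fun s' => s'.nmem = s.nmem ∧ s'.rmem = s.rmem ∧
      (∀ a, a ≠ 10 → a ≠ 13 → s'.nreg a = s.nreg a) ∧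
      (∀ a, a ≠ 3 → a ≠ 4 → s'.rreg a = s.rreg a) ∧
      s'.rreg 3 = s.rreg 3 + costFirst m lo dev D θ i ∧
      s'.rreg 4 = s.rreg 4 + costSecond m lo dev D θ i ∧
      s'.nreg 13 = buy m lo dev D θ i ∧
      (s'.nreg 10 = 1 ↔ s.nreg 10 = 1 ∧ (IsLead m lo i → IsServed m dev D θ i))) s := by
    intro hl
    simp only [leadProgram, wp, block, Test.Holds, Instr.apply, r1, r2, r7, r8]
    refine ⟨fun h1 => ?_, fun h1 => ⟨fun h2 => ?_, fun h2 => ⟨fun h3 => ?_, fun h3 =>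
      ⟨fun h4 => ?_, fun h4 => ?_⟩⟩⟩⟩ <;>
      simp +contextual [costFirst, costSecond, buy, IsServed, *]
  have hfollow : ¬ IsLead m lo i → wp followProgram (fun s' => s'.nmem = s.nmem ∧
      s'.rmem = s.rmem ∧
      (∀ a, a ≠ 10 → a ≠ 13 → s'.nreg a = s.nreg a) ∧
      (∀ a, a ≠ 3 → a ≠ 4 → s'.rreg a = s.rreg a) ∧
      s'.rreg 3 = s.rreg 3 + costFirst m lo dev D θ i ∧
      s'.rreg 4 = s.rreg 4 + costSecond m lo dev D θ i ∧
      s'.nreg 13 = buy m lo dev D θ i ∧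
      (s'.nreg 10 = 1 ↔ s.nreg 10 = 1 ∧ (IsLead m lo i → IsServed m dev D θ i))) s := by
    intro hl
    simp only [followProgram, wp, Test.Holds, Instr.apply, r1, r2, r7, r8]
    refine ⟨fun h1 => ?_, fun h1 => ⟨fun h2 => ?_, fun h2 => ⟨fun h3 => ?_, fun h3 => ?_⟩⟩⟩ <;>
      simp +contextual [costFirst, costSecond, buy, *]
  refine ⟨fun h1 => ⟨fun h2 => ⟨fun h3 => hlead ?_, fun h3 => hfollow ?_⟩, fun h2 => hlead ?_⟩,
    fun h1 => hfollow ?_⟩ <;> simp only [Test.Holds, r5, r6, h6, h7] at *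
  · exact .inr ⟨le_antisymm h1 h2, h3⟩
  · rintro (h | h)
    · exact absurd h2 h.not_ge
    · exact h3 h.2
  · exact .inl (lt_of_not_ge h2)
  · rintro (h | h)
    · exact h1 h.le
    · exact h1 h.1.le

/-- The invariant of the outer loops: thresholds `Dbest`, `θbest` with value `best` are recorded,
and `u`, `v` are the loop counters. -/
structure Frame (n : ℕ) (m : ℕ → ℕ) (lo dev : ℕ → ℝ) (u v : ℕ) (best Dbest θbest : ℝ)
    (s : State) : Prop extends Prepared n m lo dev s where
  outer : s.nreg 4 = u
  inner : s.nreg 5 = v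
  value : s.rreg 0 = best
  bestFirst : s.rreg 9 = Dbest
  bestSecond : s.rreg 10 = θbest

/-- The state of a pass that has dealt with the items below `k`. -/
structure PassState (n : ℕ) (m : ℕ → ℕ) (lo dev : ℕ → ℝ) (u v : ℕ) (best Dbest θbest D θ : ℝ)
    (k : ℕ) (s : State) : Prop extends Frame n m lo dev u v best Dbest θbest s where
  item : s.nreg 6 = k
  limitFirst : s.rreg 1 = D
  limitSecond : s.rreg 2 = θ
  first : s.rreg 3 = D + ∑ i ∈ Finset.range k, costFirst m lo dev D θ i
  second : s.rreg 4 = θ + ∑ i ∈ Finset.range k, costSecond m lo dev D θ i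
  served : s.nreg 10 = 1 ↔ ∀ i < k, IsLead m lo i → IsServed m dev D θ i
  solution : ∀ i < k, s.nmem i = buy m lo dev D θ i

variable {u v : ℕ} {best Dbest θbest : ℝ}

theorem runs_passBody (hmn : ∀ i < n, m i < n) {k : ℕ} (hk : k < n) {s : State}
    (hs : PassState n m lo dev u v best Dbest θbest D θ k s) :
    Runs passBody passBody.size (PassState n m lo dev u v best Dbest θbest D θ (k + 1)) s := by
  have hmk := hs.mate k hk
  have hlok := hs.lower k hk
  have hlom := hs.lower _ (hmn k hk)
  have hdevk := hs.deviation k hk.le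
  have hdevm := hs.deviation _ (hmn k hk).le
  have hload : wp (block [.nadd 8 0 6, .nload 7 8, .rload 5 6, .rload 6 7, .nadd 8 3 6, .rload 7 8,
      .nadd 8 3 7, .rload 8 8, .nconst 13 0])
      (fun s' => PassState n m lo dev u v best Dbest θbest D θ k s' ∧ s'.nreg 7 = m k ∧
        s'.rreg 5 = lo k ∧ s'.rreg 6 = lo (m k) ∧ s'.rreg 7 = dev k ∧ s'.rreg 8 = dev (m k) ∧
        s'.nreg 13 = 0) s := by
    simp only [wp, block, Instr.apply]
    refine ⟨⟨⟨⟨?_, ?_, ?_, ?_, hs.mate, hs.lower, hs.deviation⟩, ?_, ?_, ?_, ?_, ?_⟩, ?_, ?_, ?_,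
      ?_, ?_, ?_,
      hs.solution⟩, ?_, ?_, ?_, ?_, ?_, ?_⟩ <;>
      simp [hs.size, hs.one, hs.twice, hs.succ, hs.outer, hs.inner, hs.value,
        hs.bestFirst, hs.bestSecond, hs.item, hs.limitFirst, hs.limitSecond, hs.first, hs.second,
        hs.served, hmk, hlok, hlom,
        hdevk, hdevm]
  refine hload.runs.seq fun s1 ⟨h, h7, r5, r6, r7, r8, h13⟩ => ?_
  refine (runs_decideProgram h.item h7 h.limitFirst h.limitSecond r5 r6 r7 r8 h13).seq
    fun s2 h2 => ?_
  obtain ⟨hnm, hrm, hn, hr, hF, hS, hbuy, hserved⟩ := h2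
  have e6 : s2.nreg 6 = k := by rw [hn 6 (by norm_num) (by norm_num), h.item]
  have e1 : s2.nreg 1 = 1 := by rw [hn 1 (by norm_num) (by norm_num), h.one]
  apply wp.runs
  simp only [wp, block, Instr.apply]
  refine ⟨⟨⟨?_, ?_, ?_, ?_, ?_, ?_, ?_⟩, ?_, ?_, ?_, ?_, ?_⟩, ?_, ?_, ?_, ?_, ?_, ?_, ?_⟩
  · simpa [Function.update_apply, hn] using h.size
  · simpa [Function.update_apply, hn] using h.one
  · simpa [Function.update_apply, hn] using h.twice
  · simpa [Function.update_apply, hn] using h.succ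
  · intro i hi
    have : n + i ≠ k := by omega
    simpa [Function.update_apply, e6, this, hnm] using h.mate i hi
  · simpa [hrm] using h.lower
  · simpa [hrm] using h.deviation
  · simpa [Function.update_apply, hn] using h.outer
  · simpa [Function.update_apply, hn] using h.inner
  · simpa [hr] using h.value
  · simpa [hr] using h.bestFirst
  · simpa [hr] using h.bestSecond
  · simp [e6, e1]
  · simpa [hr] using h.limitFirst
  · simpa [hr] using h.limitSecond
  · rw [Finset.sum_range_succ, ← add_assoc, ← h.first]; exact hF
  · rw [Finset.sum_range_succ, ← add_assoc, ← h.second]; exact hS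
  · simp only [Function.update_apply, show (10 : ℕ) ≠ 6 by norm_num, if_false, hserved, h.served,
      Nat.lt_succ_iff_lt_or_eq]
    constructor
    · rintro ⟨h1, h2⟩ i (hi | rfl)
      · exact h1 i hi
      · exact h2
    · intro h1
      exact ⟨fun i hi => h1 i (.inl hi), h1 k (.inr rfl)⟩
  · intro i hi
    rcases Nat.lt_succ_iff_lt_or_eq.1 hi with hi | rfl
    · simpa [Function.update_apply, e6, hi.ne, hnm] using h.solution i hi
    · simp [e6, hbuy]

theorem runs_passProgram (hmn : ∀ i < n, m i < n) {s : State}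
    (hs : Frame n m lo dev u v best Dbest θbest s) (hD : s.rreg 1 = D) (hθ : s.rreg 2 = θ) :
    Runs passProgram (5 + (n * (passBody.size + 1) + 1))
      (PassState n m lo dev u v best Dbest θbest D θ n) s := by
  have hinit : wp (block [.nconst 6 0, .nconst 10 1, .rcopy 3 1, .rcopy 4 2])
      (PassState n m lo dev u v best Dbest θbest D θ 0) s := by
    simp only [wp, block, Instr.apply]
    refine ⟨⟨⟨?_, ?_, ?_, ?_, hs.mate, hs.lower, hs.deviation⟩, ?_, ?_, ?_, ?_, ?_⟩, ?_, ?_, ?_, ?_,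
      ?_, ?_,
      fun i hi => absurd hi (Nat.not_lt_zero i)⟩ <;>
      simp [hs.size, hs.one, hs.twice, hs.succ, hs.outer, hs.inner, hs.value,
        hs.bestFirst, hs.bestSecond, hD, hθ]
  exact hinit.runs.seq fun s' hs' => Runs.loop_lt _ (fun k s h => ⟨h.item, h.size⟩)
    (fun k s hk h => runs_passBody hmn hk h) hs'

end Pass

/-! ### The search over all pairs of thresholds -/

/-- Writes the maximum of `rreg 3` and `rreg 4`, the value of a pass, to `rreg 12`. -/
def valueProgram : Program :=
  .ite (.rle 3 4) (.instr (.rcopy 12 4)) (.instr (.rcopy 12 3))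

/-- Records the value and the thresholds of a pass. -/
def recordProgram : Program := block [.rcopy 0 12, .rcopy 9 1, .rcopy 10 2]

/-- Tries the thresholds in the cells `u = nreg 4` and `v = nreg 5`. -/
def innerBody : Program :=
  .seq (block [.nadd 8 3 4, .rload 1 8, .nadd 8 3 5, .rload 2 8])
    (.seq passProgram (.seq (.seq valueProgram
      (.ite (.neq 10 1) (.ite (.rle 0 12) .skip recordProgram) .skip)) (.instr (.nadd 5 5 1))))

/-- Tries all pairs of thresholds whose first one is in the cell `nreg 4`. -/
def outerBody : Program :=
  .seq (.loop (.nlt 5 12) innerBody) (block [.nadd 4 4 1, .nconst 5 0])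

/-- Records the thresholds initially contained in `rreg 1` and `rreg 2`, tries all pairs of
thresholds, and writes the solution of the best pair. -/
def searchProgram : Program :=
  .seq passProgram (.seq (.seq valueProgram (.seq recordProgram (block [.nconst 4 0, .nconst 5 0])))
    (.seq (.loop (.nlt 4 12) outerBody) (.seq (block [.rcopy 1 9, .rcopy 2 10]) passProgram)))

section Search

/-- All parts are served by the policy with thresholds `D` and `θ`. -/
def AllServed (n : ℕ) (m : ℕ → ℕ) (lo dev : ℕ → ℝ) (D θ : ℝ) : Prop :=
  ∀ i < n, IsLead m lo i → IsServed m dev D θ i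

/-- The cost guaranteed by the policy with thresholds `D` and `θ`. -/
noncomputable def policyValue (n : ℕ) (m : ℕ → ℕ) (lo dev : ℕ → ℝ) (D θ : ℝ) : ℝ :=
  max (D + ∑ i ∈ Finset.range n, costFirst m lo dev D θ i)
    (θ + ∑ i ∈ Finset.range n, costSecond m lo dev D θ i)

variable {n : ℕ} {m : ℕ → ℕ} {lo dev : ℕ → ℝ}

/-- The record after the pairs of thresholds before `(u, v)`, in lexicographic order, have been
tried: a pair that serves all parts, of value at most that of any such pair tried so far. -/
def SearchState (n : ℕ) (m : ℕ → ℕ) (lo dev : ℕ → ℝ) (u v : ℕ) (s : State) : Prop :=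
  ∃ best D θ, Frame n m lo dev u v best D θ s ∧ 0 ≤ D ∧ 0 ≤ θ ∧ AllServed n m lo dev D θ ∧
    best = policyValue n m lo dev D θ ∧
    (∀ u' < u, ∀ v' < n + 1, AllServed n m lo dev (dev u') (dev v') →
      best ≤ policyValue n m lo dev (dev u') (dev v')) ∧
    ∀ v' < v, AllServed n m lo dev (dev u) (dev v') →
      best ≤ policyValue n m lo dev (dev u) (dev v')

variable {u v : ℕ} {best Dbest θbest D θ : ℝ}

theorem PassState.value_eq {s : State}
    (h : PassState n m lo dev u v best Dbest θbest D θ n s) :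
    max (s.rreg 3) (s.rreg 4) = policyValue n m lo dev D θ := by
  rw [h.first, h.second, policyValue]

theorem wp_valueProgram {Q : State → Prop} {s : State}
    (h : Q { s with rreg := Function.update s.rreg 12 (max (s.rreg 3) (s.rreg 4)) }) :
    wp valueProgram Q s := by
  refine ⟨fun h1 => ?_, fun h1 => ?_⟩ <;> simp only [Test.Holds] at h1
  · simpa [wp, Instr.apply, max_eq_right h1] using h
  · simpa [wp, Instr.apply, max_eq_left (le_of_not_ge h1)] using h

theorem runs_innerBody (hmn : ∀ i < n, m i < n) (hdev : ∀ i ≤ n, 0 ≤ dev i) (hu : u < n + 1)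
    (hv : v < n + 1) {s : State} (hs : SearchState n m lo dev u v s) :
    Runs innerBody (17 + 5 + (n * (passBody.size + 1) + 1)) (SearchState n m lo dev u (v + 1))
      s := by
  obtain ⟨best, Db, θb, hs, hDb, hθb, hserved, hbest, hold, hcur⟩ := hs
  have hdu := hs.deviation u (by omega)
  have hdv := hs.deviation v (by omega)
  have hload : wp (block [.nadd 8 3 4, .rload 1 8, .nadd 8 3 5, .rload 2 8])
      (fun s' => Frame n m lo dev u v best Db θb s' ∧ s'.rreg 1 = dev u ∧ s'.rreg 2 = dev v) s := by
    simp only [wp, block, Instr.apply]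
    refine ⟨⟨⟨?_, ?_, ?_, ?_, hs.mate, hs.lower, hs.deviation⟩, ?_, ?_, ?_, ?_, ?_⟩, ?_, ?_⟩ <;>
      simp [hs.size, hs.one, hs.twice, hs.succ, hs.outer, hs.inner, hs.value, hs.bestFirst,
        hs.bestSecond, hdu, hdv]
  refine (hload.runs.seq fun s1 ⟨h1, hD, hθ⟩ => (runs_passProgram hmn h1 hD hθ).seq
    (N' := 12) (R := SearchState n m lo dev u (v + 1)) fun s2 h2 => ?_).mono ?_ fun _ h => h
  · refine Runs.mono (wp.runs ?_) (by decide) fun _ h => h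
    refine wp_valueProgram ?_
    rw [h2.value_eq]
    refine ⟨fun h3 => ⟨fun h4 => ?_, fun h4 => ?_⟩, fun h3 => ?_⟩ <;>
      simp only [Test.Holds, h2.one, h2.served] at h3
    · simp only [Test.Holds, Function.update_self, Function.update_of_ne, ne_eq,
        OfNat.zero_ne_ofNat, not_false_eq_true, h2.value] at h4
      simp only [wp, Instr.apply]
      refine ⟨best, Db, θb, ⟨⟨?_, ?_, ?_, ?_, h2.mate, h2.lower, h2.deviation⟩, ?_, ?_, ?_, ?_, ?_⟩,
        hDb, hθb, hserved, hbest, hold, fun v' hv' hser => ?_⟩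
      any_goals simp [h2.size, h2.one, h2.twice, h2.succ, h2.outer, h2.inner, h2.value,
          h2.bestFirst, h2.bestSecond]
      rcases Nat.lt_succ_iff_lt_or_eq.1 hv' with h | rfl
      · exact hcur v' h hser
      · exact h4
    · simp only [Test.Holds, Function.update_self, Function.update_of_ne, ne_eq,
        OfNat.zero_ne_ofNat, not_false_eq_true, h2.value] at h4
      have h4 := (lt_of_not_ge h4).le
      simp only [recordProgram, block, wp, Instr.apply]
      refine ⟨_, dev u, dev v, ⟨⟨?_, ?_, ?_, ?_, h2.mate, h2.lower, h2.deviation⟩, ?_, ?_, ?_, ?_,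
        ?_⟩, hdev u (by omega), hdev v (by omega), h3, rfl,
        fun u' hu' v' hv' hser => h4.trans (hold u' hu' v' hv' hser), fun v' hv' hser => ?_⟩
      any_goals simp [h2.size, h2.one, h2.twice, h2.succ, h2.outer, h2.inner, h2.limitFirst,
          h2.limitSecond]
      rcases Nat.lt_succ_iff_lt_or_eq.1 hv' with h | rfl
      · exact h4.trans (hcur v' h hser)
      · exact le_rfl
    · simp only [wp, Instr.apply]
      refine ⟨best, Db, θb, ⟨⟨?_, ?_, ?_, ?_, h2.mate, h2.lower, h2.deviation⟩, ?_, ?_, ?_, ?_, ?_⟩,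
        hDb, hθb, hserved, hbest, hold, fun v' hv' hser => ?_⟩
      any_goals simp [h2.size, h2.one, h2.twice, h2.succ, h2.outer, h2.inner, h2.value,
          h2.bestFirst, h2.bestSecond]
      rcases Nat.lt_succ_iff_lt_or_eq.1 hv' with h | rfl
      · exact hcur v' h hser
      · exact absurd hser h3
  · simp only [Program.size, block]; omega

theorem runs_outerBody (hmn : ∀ i < n, m i < n) (hdev : ∀ i ≤ n, 0 ≤ dev i) (hu : u < n + 1)
    {s : State} (hs : SearchState n m lo dev u 0 s) :
    Runs outerBody ((n + 1) * (17 + 5 + (n * (passBody.size + 1) + 1) + 1) + 1 + 3)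
      (SearchState n m lo dev (u + 1) 0) s := by
  refine (Runs.loop_lt (N := n + 1) (SearchState n m lo dev u)
    (fun k s h => ?_) (fun k s hk h => runs_innerBody hmn hdev hu hk h) hs).seq
    fun s2 h2 => ?_
  · obtain ⟨_, _, _, h, -⟩ := h
    exact ⟨h.inner, h.succ⟩
  · obtain ⟨best, Db, θb, hs, hDb, hθb, hserved, hbest, hold, hcur⟩ := h2
    refine Runs.mono (N := (block [.nadd 4 4 1, .nconst 5 0]).size) (wp.runs ?_) (by decide)
      fun _ h => h
    simp only [block, wp, Instr.apply]
    refine ⟨best, Db, θb, ⟨⟨?_, ?_, ?_, ?_, hs.mate, hs.lower, hs.deviation⟩, ?_, ?_, ?_, ?_,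
      ?_⟩, hDb, hθb, hserved, hbest, fun u' hu' v' hv' hser => ?_,
      fun v' hv' => absurd hv' (Nat.not_lt_zero v')⟩
    any_goals simp [hs.size, hs.one, hs.twice, hs.succ, hs.outer, hs.value, hs.bestFirst,
      hs.bestSecond]
    rcases Nat.lt_succ_iff_lt_or_eq.1 hu' with h | rfl
    · exact hold u' h v' hv' hser
    · exact hcur v' hv' hser

/-- The search ends with the solution of a pair of thresholds whose value is least among all pairs
`dev u`, `dev v`. -/
theorem runs_searchProgram (hmn : ∀ i < n, m i < n) (hdev : ∀ i ≤ n, 0 ≤ dev i) {s : State}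
    (hs : Prepared n m lo dev s) (hD : s.rreg 1 = D) (hθ : s.rreg 2 = θ) (hD0 : 0 ≤ D)
    (hθ0 : 0 ≤ θ) (hserved : AllServed n m lo dev D θ) :
    Runs searchProgram ((5 + (n * (passBody.size + 1) + 1)) + (10 +
      (((n + 1) * ((n + 1) * (17 + 5 + (n * (passBody.size + 1) + 1) + 1) + 1 + 3 + 1) + 1) +
        (3 + (5 + (n * (passBody.size + 1) + 1))))))
      (fun s' => ∃ D θ, 0 ≤ D ∧ 0 ≤ θ ∧ AllServed n m lo dev D θ ∧
        (∀ i < n, s'.nmem i = buy m lo dev D θ i) ∧ s'.rreg 0 = policyValue n m lo dev D θ ∧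
        ∀ u < n + 1, ∀ v < n + 1, AllServed n m lo dev (dev u) (dev v) →
          s'.rreg 0 ≤ policyValue n m lo dev (dev u) (dev v)) s := by
  refine (runs_passProgram hmn ⟨hs, rfl, rfl, rfl, rfl, rfl⟩ hD hθ).seq fun s1 h1 => ?_
  refine Runs.seq (N := 10) (Q := SearchState n m lo dev 0 0) ?_ fun s2 h2 => ?_
  · refine Runs.mono (wp.runs ?_) (by decide) fun _ h => h
    refine wp_valueProgram ?_
    rw [h1.value_eq]
    simp only [recordProgram, block, wp, Instr.apply]
    refine ⟨_, D, θ, ⟨⟨?_, ?_, ?_, ?_, h1.mate, h1.lower, h1.deviation⟩, ?_, ?_, ?_, ?_,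
        ?_⟩, hD0, hθ0, hserved, rfl, fun u' hu' => absurd hu' (Nat.not_lt_zero u'),
        fun v' hv' => absurd hv' (Nat.not_lt_zero v')⟩ <;>
    simp [h1.size, h1.one, h1.twice, h1.succ, h1.limitFirst, h1.limitSecond]
  refine (Runs.loop_lt (N := n + 1) (fun u => SearchState n m lo dev u 0)
    (fun k s h => ?_) (fun k s hk h => runs_outerBody hmn hdev hk h) h2).seq fun s3 h3 => ?_
  · obtain ⟨_, _, _, h, -⟩ := h
    exact ⟨h.outer, h.succ⟩
  obtain ⟨best, Db, θb, h, hDb, hθb, hserved, hbest, hold, -⟩ := h3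
  have hcopy : wp (block [.rcopy 1 9, .rcopy 2 10])
      (fun s' => Frame n m lo dev (n + 1) 0 best Db θb s' ∧ s'.rreg 1 = Db ∧ s'.rreg 2 = θb)
      s3 := by
    simp only [wp, block, Instr.apply]
    refine ⟨⟨⟨h.size, h.one, h.twice, h.succ, h.mate, h.lower, h.deviation⟩, h.outer, h.inner, ?_,
      ?_, ?_⟩, ?_, ?_⟩ <;> simp [h.value, h.bestFirst, h.bestSecond]
  refine hcopy.runs.seq fun s4 ⟨h4, e1, e2⟩ => (runs_passProgram hmn h4 e1 e2).mono le_rfl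
    fun s5 h5 => ⟨Db, θb, hDb, hθb, hserved, h5.solution, h5.value.trans hbest, ?_⟩
  rw [h5.value]
  exact hold

end Search

/-! ### Preparation of the input -/

/-- Compares the part of the item in `nreg 7` with `nreg 9`, the part of the item in `nreg 6`. -/
def mateBody : Program :=
  .seq (.ite (.neq 7 6) .skip (.seq (.instr (.nload 13 7))
    (.ite (.neq 13 9) (block [.nadd 8 0 6, .nstore 8 7]) .skip))) (.instr (.nadd 7 7 1))

/-- Writes the mate of item `i` to the natural memory cell `n + i`. -/
def mateProgram : Program :=
  .seq (block [.nconst 1 1, .nadd 3 0 0, .nadd 12 0 1, .nconst 6 0])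
    (.loop (.nlt 6 0) (.seq (block [.nload 9 6, .nconst 7 0])
      (.seq (.loop (.nlt 7 0) mateBody) (.instr (.nadd 6 6 1)))))

/-- Writes the deviation of the item in `nreg 6` and adds it to `rreg 11`. -/
def deviationBody : Program :=
  block [.rload 5 6, .nadd 8 0 6, .rload 7 8, .rsub 7 7 5, .nadd 8 3 6, .rstore 8 7,
    .radd 11 11 7, .nadd 6 6 1]

/-- Writes the deviations to the real memory cells from `2 * n` on, followed by the threshold `0`,
and the sum of all deviations, as initial thresholds, to `rreg 1` and `rreg 2`. -/
def deviationProgram : Program :=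
  .seq (block [.nconst 6 0, .rsub 11 11 11]) (.seq (.loop (.nlt 6 0) deviationBody)
    (block [.nadd 8 3 0, .rsub 5 5 5, .rstore 8 5, .rcopy 1 11, .rcopy 2 11]))

section Prepare

variable {n : ℕ} {part m : ℕ → ℕ} {mem dev : ℕ → ℝ}

/-- The mates of the items below `i` have been written. -/
structure MateState (n : ℕ) (part m : ℕ → ℕ) (mem : ℕ → ℝ) (i : ℕ) (s : State) : Prop where
  size : s.nreg 0 = n
  one : s.nreg 1 = 1
  twice : s.nreg 3 = n + n
  succ : s.nreg 12 = n + 1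
  item : s.nreg 6 = i
  labels : ∀ j < n, s.nmem j = part j
  mate : ∀ j < i, s.nmem (n + j) = m j
  memory : s.rmem = mem

/-- The items below `k` have been compared with item `i`. -/
structure CompareState (n : ℕ) (part m : ℕ → ℕ) (mem : ℕ → ℝ) (i k : ℕ) (s : State) : Prop
    extends MateState n part m mem i s where
  key : s.nreg 9 = part i
  other : s.nreg 7 = k
  found : m i < k → s.nmem (n + i) = m i

theorem runs_mateBody (hpart : ∀ i < n, ∀ k < n, part k = part i ∧ k ≠ i ↔ k = m i) {i k : ℕ}
    (hi : i < n) (hk : k < n) {s : State} (hs : CompareState n part m mem i k s) :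
    Runs mateBody mateBody.size (CompareState n part m mem i (k + 1)) s := by
  have hpk := hs.labels k hk
  have hmk := hpart i hi k hk
  apply wp.runs
  refine ⟨fun h1 => ?_, fun h1 => ⟨fun h2 => ?_, fun h2 => ?_⟩⟩ <;>
    simp only [Test.Holds, hs.item, hs.other] at h1
  · have hne : m i ≠ k := fun h => (hmk.2 h.symm).2 h1
    simp only [wp, Instr.apply]
    refine ⟨⟨?_, ?_, ?_, ?_, ?_, hs.labels, hs.mate, hs.memory⟩, ?_, ?_,
      fun h => hs.found (by omega)⟩
      <;> simp [hs.size, hs.one, hs.twice, hs.succ, hs.item, hs.key, hs.other]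
  · have h2 : part k = part i := by simpa [Test.Holds, Instr.apply, hs.other, hs.key, hpk] using h2
    have hki := hmk.1 ⟨h2, h1⟩
    simp only [wp, block, Instr.apply]
    refine ⟨⟨?_, ?_, ?_, ?_, ?_, fun j hj => ?_, fun j hj => ?_, hs.memory⟩, ?_, ?_, fun h => ?_⟩
    any_goals simp [hs.size, hs.one, hs.twice, hs.succ, hs.item, hs.key, hs.other, ← hki]
    · rw [Function.update_of_ne (by omega)]; exact hs.labels j hj
    · rw [Function.update_of_ne (by omega)]; exact hs.mate j hj
  · have h2 : part k ≠ part i := by simpa [Test.Holds, Instr.apply, hs.other, hs.key, hpk] using h2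
    have hne : m i ≠ k := fun h => h2 (hmk.2 h.symm).1
    simp only [wp, Instr.apply]
    refine ⟨⟨?_, ?_, ?_, ?_, ?_, hs.labels, hs.mate, hs.memory⟩, ?_, ?_,
      fun h => hs.found (by omega)⟩
      <;> simp [hs.size, hs.one, hs.twice, hs.succ, hs.item, hs.key, hs.other]

theorem runs_mateProgram (hmn : ∀ i < n, m i < n)
    (hpart : ∀ i < n, ∀ k < n, part k = part i ∧ k ≠ i ↔ k = m i) {s : State}
    (hsize : s.nreg 0 = n) (hs : ∀ j < n, s.nmem j = part j) (hmem : s.rmem = mem) :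
    Runs mateProgram (5 + (n * (3 + ((n * (mateBody.size + 1) + 1) + 1) + 1) + 1))
      (MateState n part m mem n) s := by
  have hinit : wp (block [.nconst 1 1, .nadd 3 0 0, .nadd 12 0 1, .nconst 6 0])
      (MateState n part m mem 0) s := by
    simp only [wp, block, Instr.apply]
    refine ⟨?_, ?_, ?_, ?_, ?_, hs, fun j hj => absurd hj (Nat.not_lt_zero j), hmem⟩ <;>
      simp [hsize]
  refine hinit.runs.seq fun s1 h1 => Runs.loop_lt (MateState n part m mem)
    (fun _ _ h => ⟨h.item, h.size⟩) (fun i s2 hi h2 => ?_) h1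
  have hpi := h2.labels i hi
  have hload : wp (block [.nload 9 6, .nconst 7 0]) (CompareState n part m mem i 0) s2 := by
    simp only [wp, block, Instr.apply]
    refine ⟨⟨?_, ?_, ?_, ?_, ?_, h2.labels, h2.mate, h2.memory⟩, ?_, ?_,
      fun h => absurd h (Nat.not_lt_zero _)⟩ <;>
      simp [h2.size, h2.one, h2.twice, h2.succ, h2.item, hpi]
  refine hload.runs.seq fun s3 h3 => (Runs.loop_lt (CompareState n part m mem i)
    (fun _ _ h => ⟨h.other, h.size⟩) (fun k s4 hk h4 => runs_mateBody hpart hi hk h4) h3).seq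
    fun s5 h5 => wp.runs ?_
  simp only [wp, Instr.apply]
  refine ⟨?_, ?_, ?_, ?_, ?_, h5.labels, fun j hj => ?_, h5.memory⟩
  any_goals simp [h5.size, h5.one, h5.twice, h5.succ, h5.item]
  rcases Nat.lt_succ_iff_lt_or_eq.1 hj with h | rfl
  · exact h5.mate j h
  · exact h5.found (hmn j hi)

/-- The deviations of the items below `i` have been written and summed up. -/
structure DeviationState (n : ℕ) (m : ℕ → ℕ) (mem : ℕ → ℝ) (i : ℕ) (s : State) : Prop where
  size : s.nreg 0 = n
  one : s.nreg 1 = 1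
  twice : s.nreg 3 = n + n
  succ : s.nreg 12 = n + 1
  item : s.nreg 6 = i
  mate : ∀ j < n, s.nmem (n + j) = m j
  memory : ∀ j < n + n, s.rmem j = mem j
  deviation : ∀ j < i, s.rmem (n + n + j) = mem (n + j) - mem j
  sum : s.rreg 11 = ∑ j ∈ Finset.range i, (mem (n + j) - mem j)

theorem runs_deviationBody {i : ℕ} (hi : i < n) {s : State} (hs : DeviationState n m mem i s) :
    Runs deviationBody deviationBody.size (DeviationState n m mem (i + 1)) s := by
  have h1 := hs.memory i (by omega)
  have h2 := hs.memory (n + i) (by omega)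
  apply wp.runs
  simp only [deviationBody, wp, block, Instr.apply]
  refine ⟨?_, ?_, ?_, ?_, ?_, hs.mate, fun j hj => ?_, fun j hj => ?_, ?_⟩
  any_goals simp [hs.size, hs.one, hs.twice, hs.succ, hs.item, hs.sum, h1, h2,
    Finset.sum_range_succ]
  · rw [Function.update_of_ne (by omega)]; exact hs.memory j hj
  · rcases Nat.lt_succ_iff_lt_or_eq.1 hj with h | rfl
    · rw [Function.update_of_ne (by omega)]; exact hs.deviation j h
    · simp
  · ring

theorem runs_deviationProgram (hdev : ∀ i < n, dev i = mem (n + i) - mem i) (hdevn : dev n = 0)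
    {s : State} (hs : MateState n part m mem n s) :
    Runs deviationProgram (3 + ((n * (deviationBody.size + 1) + 1) + 6))
      (fun s' => Prepared n m mem dev s' ∧ s'.rreg 1 = ∑ j ∈ Finset.range n, dev j ∧
        s'.rreg 2 = ∑ j ∈ Finset.range n, dev j) s := by
  have hinit : wp (block [.nconst 6 0, .rsub 11 11 11]) (DeviationState n m mem 0) s := by
    simp only [wp, block, Instr.apply]
    refine ⟨?_, ?_, ?_, ?_, ?_, hs.mate, fun j _ => congrFun hs.memory j,
      fun j hj => absurd hj (Nat.not_lt_zero j), ?_⟩ <;>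
      simp [hs.size, hs.one, hs.twice, hs.succ]
  refine hinit.runs.seq fun s1 h1 => (Runs.loop_lt (DeviationState n m mem)
    (fun _ _ h => ⟨h.item, h.size⟩) (fun i s2 hi h2 => runs_deviationBody hi h2) h1).seq
    fun s3 h3 => wp.runs ?_
  have hsum : s3.rreg 11 = ∑ j ∈ Finset.range n, dev j := by
    rw [h3.sum]
    exact Finset.sum_congr rfl fun j hj => (hdev j (Finset.mem_range.1 hj)).symm
  simp only [wp, block, Instr.apply]
  refine ⟨⟨?_, ?_, ?_, ?_, h3.mate, fun j hj => ?_, fun j hj => ?_⟩, ?_, ?_⟩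
  any_goals simp [h3.size, h3.one, h3.twice, h3.succ, hsum]
  · rw [Function.update_of_ne (by omega)]; exact h3.memory j (by omega)
  · rcases hj.lt_or_eq with h | rfl
    · rw [Function.update_of_ne (by omega), h3.deviation j h, hdev j h]
    · simp [hdevn]

end Prepare

/-! ### The algorithm -/

section Transfer

variable {n : ℕ} {m : Fin n → Fin n} {m' : ℕ → ℕ} {lo dev : Fin n → ℝ} {lo' dev' : ℕ → ℝ}

theorem isLead_coe (hm : ∀ i, m' (i : Fin n) = m i) (hlo : ∀ i, lo' (i : Fin n) = lo i)
    (i : Fin n) : IsLead m' lo' i ↔ IsLead m lo i := by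
  simp only [IsLead, hm, hlo, Fin.lt_def]

theorem isServed_coe (hm : ∀ i, m' (i : Fin n) = m i) (hdev : ∀ i, dev' (i : Fin n) = dev i)
    {D θ : ℝ} (i : Fin n) : IsServed m' dev' D θ i ↔ IsServed m dev D θ i := by
  simp only [IsServed, hm, hdev]

theorem allServed_iff (hm : ∀ i, m' (i : Fin n) = m i) (hlo : ∀ i, lo' (i : Fin n) = lo i)
    (hdev : ∀ i, dev' (i : Fin n) = dev i) {D θ : ℝ} :
    AllServed n m' lo' dev' D θ ↔ ∀ i, IsLead m lo i → IsServed m dev D θ i := by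
  simp only [← isLead_coe hm hlo, ← isServed_coe hm hdev]
  exact ⟨fun h i => h i i.2, fun h i hi => h ⟨i, hi⟩⟩

theorem buy_coe (hm : ∀ i, m' (i : Fin n) = m i) (hlo : ∀ i, lo' (i : Fin n) = lo i)
    (hdev : ∀ i, dev' (i : Fin n) = dev i) {D θ : ℝ} (i : Fin n) :
    buy m' lo' dev' D θ i = buy m lo dev D θ i := by
  have h := isLead_coe hm hlo i
  by_cases hl : IsLead m lo i <;> simp [buy, h, hl, hm, hdev]

theorem policyValue_eq (hm : ∀ i, m' (i : Fin n) = m i) (hlo : ∀ i, lo' (i : Fin n) = lo i)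
    (hdev : ∀ i, dev' (i : Fin n) = dev i) {D θ : ℝ} :
    policyValue n m' lo' dev' D θ = max (D + ∑ i, costFirst m lo dev D θ i)
      (θ + ∑ i, costSecond m lo dev D θ i) := by
  rw [policyValue, Finset.sum_range, Finset.sum_range]
  congr 2 <;> refine Finset.sum_congr rfl fun i _ => ?_
  · have h := isLead_coe hm hlo i
    by_cases hl : IsLead m lo i <;> simp [costFirst, h, hl, hm, hlo, hdev]
  · have h := isLead_coe hm hlo i
    by_cases hl : IsLead m lo i <;> simp [costSecond, h, hl, hm, hlo, hdev]

end Transfer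

end TwoStage

open TwoStage in
theorem mainTheorem8 :
    ∃ (P : TwoStage.Program) (time : ℕ → ℕ),
      Asymptotics.IsBigO Filter.atTop (fun n : ℕ => (time n : ℝ)) (fun n : ℕ => (n : ℝ) ^ 3) ∧
      ∀ (n ℓ : ℕ) (T : Fin ℓ → Finset (Fin n)) (lo hi : Fin n → ℝ),
        TwoStage.IsItemPartition T → (∀ j, (T j).card = 2) →
        (∀ i, 0 ≤ lo i ∧ lo i ≤ hi i) →
        ∀ s : TwoStage.State, TwoStage.HoldsInput T lo hi s →
          ∃ (t : ℕ) (s' : TwoStage.State), TwoStage.Exec P s t s' ∧ t ≤ time n ∧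
            TwoStage.HoldsOptimum (TwoStage.repSelectionEqualCosts T lo hi) s' := by
  refine ⟨.seq mateProgram (.seq deviationProgram searchProgram), fun n => 200 * (n + 1) ^ 3, ?_,
    ?_⟩
  · refine Asymptotics.IsBigO.of_bound (200 * 2 ^ 3) ?_
    filter_upwards [Filter.eventually_ge_atTop 1] with n hn
    have h1 : (1 : ℝ) ≤ n := by exact_mod_cast hn
    have h2 : ((n : ℝ) + 1) ^ 3 ≤ (2 * n) ^ 3 := by gcongr; linarith
    rw [Real.norm_of_nonneg (by positivity), Real.norm_of_nonneg (by positivity)]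
    push_cast
    rw [mul_pow] at h2
    linarith
  rintro n ℓ T lo hi hT h2 hlohi s ⟨hsize, -, hlabel, hlo, hhi⟩
  obtain ⟨m, hm, hne, hmate, hX⟩ := exists_mate hT h2
  set dev : Fin n → ℝ := fun i => hi i - lo i with hdev
  obtain ⟨m', hm'⟩ : ∃ m' : ℕ → ℕ, ∀ i : Fin n, m' i = m i :=
    ⟨fun i => if h : i < n then m ⟨i, h⟩ else 0, fun i => by simp⟩
  set dev' : ℕ → ℝ := fun i => if i = n then 0 else s.rmem (n + i) - s.rmem i with hdev'
  have hdevcoe : ∀ i : Fin n, dev' i = dev i := fun i => by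
    simp [hdev', hdev, i.2.ne, hlo, hhi]
  have hmn : ∀ i < n, m' i < n := fun i hi => by
    have := hm' ⟨i, hi⟩
    simp only at this
    rw [this]
    exact (m _).2
  have hpart : ∀ i < n, ∀ k < n, s.nmem k = s.nmem i ∧ k ≠ i ↔ k = m' i := by
    intro i hi k hk
    obtain ⟨j, hj⟩ := hT.2 ⟨i, hi⟩
    obtain ⟨j', hj'⟩ := hT.2 ⟨k, hk⟩
    have h1 := hlabel _ _ hj
    have h2 := hlabel _ _ hj'
    have h3 := hmate ⟨i, hi⟩ ⟨k, hk⟩ j hj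
    have h4 : (⟨k, hk⟩ : Fin n) ∈ T j ↔ j' = j := by
      refine ⟨fun h => ?_, fun h => h ▸ hj'⟩
      by_contra hne
      exact Finset.disjoint_left.1 (hT.1 _ _ hne) hj' h
    have h5 := hm' ⟨i, hi⟩
    simp only at h1 h2 h5
    rw [h4] at h3
    rw [h1, h2, h5]
    simpa [Fin.ext_iff] using h3
  have hdev0 : ∀ i ≤ n, 0 ≤ dev' i := fun i hi => by
    rcases hi.lt_or_eq with h | rfl
    · have := hdevcoe ⟨i, h⟩
      simp only at this
      rw [this]
      exact sub_nonneg.2 (hlohi _).2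
    · simp [hdev']
  have hsum0 : 0 ≤ ∑ j ∈ Finset.range n, dev' j :=
    Finset.sum_nonneg fun i hi => hdev0 i (Finset.mem_range.1 hi).le
  -- the initial thresholds admit every item
  have hserved : AllServed n m' s.rmem dev' (∑ j ∈ Finset.range n, dev' j)
      (∑ j ∈ Finset.range n, dev' j) := fun i hi _ =>
    .inl (Finset.single_le_sum (fun i hi => hdev0 i (Finset.mem_range.1 hi).le)
      (Finset.mem_range.2 hi))
  have hrun := (runs_mateProgram hmn hpart hsize (fun _ _ => rfl) rfl).seq fun s1 h1 =>
    (runs_deviationProgram (dev := dev') (fun i hi => by simp [hdev', hi.ne]) (by simp [hdev'])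
      h1).seq fun s2 ⟨h2, e1, e2⟩ => runs_searchProgram hmn hdev0 h2 e1 e2 hsum0 hsum0 hserved
  obtain ⟨t, s', hexec, ht, D, θ, hD, hθ, hall, hsol, hval, hbest⟩ := hrun
  refine ⟨t, s', hexec, ht.trans ?_, ?_⟩
  -- the dominant term is one step of a pass for each triple of two thresholds and an item
  · rw [show passBody.size = 72 from rfl, show mateBody.size = 9 from rfl,
      show deviationBody.size = 9 from rfl]
    ring_nf
    nlinarith
  rw [allServed_iff hm' hlo hdevcoe] at hall
  have hsolution : s'.solution n = fun i => (buy m lo dev D θ i : ℝ) := by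
    funext i
    rw [State.solution, hsol i i.2, buy_coe hm' hlo hdevcoe]
  have hbinary : s'.solution n ∈ binary n := fun i => by
    rw [hsolution]
    rcases buy_eq_zero_or_one (m := m) (lo := lo) (dev := dev) (D := D) (θ := θ) (i := i) with h | h
      <;> simp [h]
  have hupper : (repSelectionEqualCosts T lo hi).adv (s'.solution n) ≤ (s'.rreg 0 : EReal) := by
    rw [hsolution, hval, policyValue_eq hm' hlo hdevcoe]
    exact adv_buy_le hm hne hX hD hθ hall
  have hlower : (s'.rreg 0 : EReal) ≤ (repSelectionEqualCosts T lo hi).rob := by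
    refine le_iInf₂ fun x hx => le_adv_of_forall_policy hlohi hm hne hX ?_ hx
    -- each threshold is a cell of the array of thresholds, `0` being the last one
    have hcell : ∀ E : ℝ, (E = 0 ∨ ∃ u, E = hi u - lo u) → ∃ u < n + 1, dev' u = E := by
      rintro E (rfl | ⟨u, rfl⟩)
      · exact ⟨n, by omega, by simp [hdev']⟩
      · exact ⟨u, by omega, hdevcoe u⟩
    intro D θ hD hθ h
    obtain ⟨u, hu, rfl⟩ := hcell D hD
    obtain ⟨v, hv, rfl⟩ := hcell θ hθ
    rw [← policyValue_eq hm' hlo hdevcoe]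
    exact hbest u hu v hv ((allServed_iff hm' hlo hdevcoe).2 h)
  have hle : (repSelectionEqualCosts T lo hi).rob ≤
      (repSelectionEqualCosts T lo hi).adv (s'.solution n) := iInf₂_le _ hbinary
  exact ⟨hbinary, le_antisymm (hupper.trans hlower) hle, le_antisymm (hle.trans hupper) hlower⟩
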